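/- Write $\mathbb{Z}_2=\mathbb{Z}/2\mathbb{Z}$. Let $p,q\ge 0$ be integers with $n=p+q\ge 3$. The real algebra $\mathbb{O}_{p,q}$ is the twisted group algebra with basis $\{u_x : x\in\mathbb{Z}_2^n\}$ and product $u_x\cdot u_y=(-1)^{f(x,y)}u_{x+y}$, where $$f(x,y)=\sum_{1\le i<j<k\le n}(x_ix_jy_k+x_iy_jx_k+y_ix_jx_k)+\sum_{1\le i\le j\le n}x_iy_j+\sum_{1\le i\le p}x_iy_i .$$ Let $$\alpha_{p,q}(x)=\sum_{1\le i<j<k\le n}x_ix_jx_k+\sum_{1\le i<j\le n}x_ix_j+\sum_{1\le i\le n}x_i+\sum_{1\le i\le p}x_i .$$ **Normal forms.** The forms $\tilde\alpha_{p,q}$ ($p+q\ge3$) are functions of $x_1,\dots,x_{p+q}\in\mathbb{Z}_2$ defined as follows. *Signature $(0,n)$.* Put $$\tilde\alpha_{0,3}=x_1x_2x_3+x_1x_2+x_1x_3+x_2x_3+x_1+x_2+x_3,$$ $$\tilde\alpha_{0,4}=x_1x_3x_4+x_1x_3+x_1x_4+x_3x_4+x_1+x_3+x_4,$$ $$\tilde\alpha_{0,5}=x_1x_2x_3+x_1x_4x_5+x_2x_3+x_1x_4+x_1x_5+x_4x_5+x_1+x_4+x_5,$$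 $$\tilde\alpha_{0,6}=x_1x_3x_4+x_1x_5x_6+x_1x_2+x_3x_4+x_1x_5+x_1x_6+x_5x_6+x_1+x_2+x_5+x_6,$$ and, for $m\in\{3,4,5,6\}$ and $k\ge0$, $$\tilde\alpha_{0,m+4k}(x)=\tilde\alpha_{0,m}(x_1,\dots,x_m)+\sum_{i=1}^{k}\bigl(x_1+\tilde\alpha_{0,5}(x_1,x_{m+4i-3},x_{m+4i-2},x_{m+4i-1},x_{m+4i})\bigr).$$ *Signature $(n,0)$.* $\tilde\alpha_{n,0}(x)=\tilde\alpha_{0,n}(x)+x_1$. *Signature $(p,q)$ with $p,q>0$.* The initial forms are $$\begin{aligned} \tilde\alpha_{1,2}&=x_1x_2x_3+x_1x_2+x_1x_3+x_2x_3+x_1,\\ \tilde\alpha_{2,2}&=x_1x_3x_4+x_1x_3+x_1x_4+x_3x_4+x_1,\\ \tilde\alpha_{1,3}&=x_1x_3x_4+x_1x_3+x_1x_4+x_3x_4+x_1+x_2+x_4,\\ \tilde\alpha_{2,3}&=x_1x_2x_3+x_1x_4x_5+x_2x_3+x_1x_4+x_1x_5+x_4x_5+x_1,\\ \tilde\alpha_{1,4}&=\tilde\alpha_{2,3}+x_2+x_3,\\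 \tilde\alpha_{3,3}&=x_1x_3x_4+x_1x_5x_6+x_1x_2+x_3x_4+x_1x_5+x_1x_6+x_5x_6+x_1,\\ \tilde\alpha_{2,4}&=\tilde\alpha_{3,3}+x_2+x_3+x_4,\\ \tilde\alpha_{1,5}&=\tilde\alpha_{3,3}+x_5+x_6,\\ \tilde\alpha_{2,5}&=x_1x_2x_3+x_1x_4x_5+x_1x_6x_7+x_1x_2+x_1x_3+x_2x_3+x_4x_5+x_1x_6+x_1x_7+x_6x_7+x_1+x_6+x_7,\\ \tilde\alpha_{2,6}&=x_1x_3x_4+x_1x_5x_6+x_1x_7x_8+x_1x_3+x_1x_4+x_3x_4+x_5x_6+x_1x_7+x_1x_8+x_7x_8+x_1+x_7+x_8,\\ \tilde\alpha_{3,6}&=x_1x_2x_3+x_1x_4x_5+x_1x_6x_7+x_1x_8x_9+x_2x_3+x_4x_5+x_1x_6+x_1x_7+x_6x_7\\ &\quad+x_1x_8+x_1x_9+x_8x_9+x_1+x_8+x_9. \end{aligned}$$ All other forms with $p,q>0$ and $p+q\ge3$ are obtained from these by the following rules (which determine them without contradiction): * (a) $\tilde\alpha_{q,p}=\tilde\alpha_{p,q}$;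 * (b) $\tilde\alpha_{p,q+4}=\tilde\alpha_{p+4,q}$; * (c) if $(p,q)\ne(1,4),(4,1)$, then with $n=p+q$, $$\tilde\alpha_{p+2,q+2}(x_1,\dots,x_{n+4})=\tilde\alpha_{p,q}(x_1,\dots,x_n)+\tilde\alpha_{2,3}(x_1,x_{n+1},x_{n+2},x_{n+3},x_{n+4})+x_1 .$$ **Theorem.** 1. For all $p,q\ge0$ with $n=p+q\ge3$, $\alpha_{p,q}$ is the generating function of $\mathbb{O}_{p,q}$, that is, for all $x,y,z\in\mathbb{Z}_2^n$, writing $\alpha=\alpha_{p,q}$: $f(x,x)=\alpha(x)$; $f(x,y)+f(y,x)=\alpha(x+y)+\alpha(x)+\alpha(y)$; and $$\begin{aligned}f(x,y)+f(x,y+z)+f(x+y,z)+f(y,z)={}&\alpha(x+y+z)+\alpha(x+y)+\alpha(x+z)+\alpha(y+z)\\&+\alpha(x)+\alpha(y)+\alpha(z).\end{aligned}$$ Moreover $\alpha_{p,q}$ and $\tilde\alpha_{p,q}$ are equivalent: there is $G\in\mathrm{GL}_n(\mathbb{Z}_2)$ with $\alpha_{p,q}(x)=\tilde\alpha_{p,q}(Gx)$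 for all $x\in\mathbb{Z}_2^n$. 2. The normal forms are periodic modulo $4$: for $n\ge3$, $$\tilde\alpha_{0,n+4}(x_1,\dots,x_{n+4})=\tilde\alpha_{0,n}(x_1,\dots,x_n)+\tilde\alpha_{0,5}(x_1,x_{n+1},\dots,x_{n+4})+x_1,$$ $$\tilde\alpha_{n+4,0}(x_1,\dots,x_{n+4})=\tilde\alpha_{n,0}(x_1,\dots,x_n)+\tilde\alpha_{0,5}(x_1,x_{n+1},\dots,x_{n+4})+x_1$$ (the last two terms are $\tilde\alpha_{5,0}(x_1,x_{n+1},\dots,x_{n+4})$), and (a), (b) hold for all $p,q>0$ (with $p+q\ge 3$ in (a)), and (c) for all $p,q>0$ with $p+q\ge3$ and $(p,q)\ne(1,4),(4,1)$. -/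

import Mathlib

open scoped Matrix

namespace HigherOctonion

/-- `ZMod 2`-valued functions on the vector space `(ZMod 2)^n`; every form below is one of these. -/
abbrev Form (n : ℕ) : Type := (Fin n → ZMod 2) → ZMod 2

/-- Equivalence of forms on `(ZMod 2)^n`: `α(x) = α'(G x)` for some `G` in `GL_n(ZMod 2)`. -/
def Equivalent {n : ℕ} (α α' : Form n) : Prop :=
  ∃ G : Matrix.GeneralLinearGroup (Fin n) (ZMod 2),
    ∀ x : Fin n → ZMod 2, α x = α' ((G : Matrix (Fin n) (Fin n) (ZMod 2)) *ᵥ x)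

/-- `α` is a generating function of the twisted group algebra with basis `u_x`
(`x` in `(ZMod 2)^n`) and product `u_x u_y = (-1)^(f(x,y)) u_(x+y)`. -/
structure IsGeneratingFunction {n : ℕ}
    (f : (Fin n → ZMod 2) → (Fin n → ZMod 2) → ZMod 2) (α : Form n) : Prop where
  diag : ∀ x, f x x = α x
  comm : ∀ x y, f x y + f y x = α (x + y) + α x + α y
  assoc : ∀ x y z, f x y + f x (y + z) + f (x + y) z + f y z =
    α (x + y + z) + α (x + y) + α (x + z) + α (y + z) + α x + α y + α z

/-- The twisting function of the complex algebra `𝕆_n`. -/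
def twistN (n : ℕ) (x y : Fin n → ZMod 2) : ZMod 2 :=
  (∑ i : Fin n, ∑ j ∈ Finset.Ioi i, ∑ k ∈ Finset.Ioi j,
      (x i * x j * y k + x i * y j * x k + y i * x j * x k)) +
    ∑ i : Fin n, ∑ j ∈ Finset.Ici i, x i * y j

/-- The twisting function of the real algebra `𝕆_{p,q}`. -/
def twist (p q : ℕ) (x y : Fin (p + q) → ZMod 2) : ZMod 2 :=
  twistN (p + q) x y + ∑ i : Fin (p + q) with i.val < p, x i * y i

/-- The cubic form `α_n`. -/
def alphaN (n : ℕ) : Form n := fun x =>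
  (∑ i : Fin n, ∑ j ∈ Finset.Ioi i, ∑ k ∈ Finset.Ioi j, x i * x j * x k) +
    (∑ i : Fin n, ∑ j ∈ Finset.Ioi i, x i * x j) + ∑ i : Fin n, x i

/-- The cubic form `α_{p,q}`. -/
def alpha (p q : ℕ) : Form (p + q) := fun x =>
  alphaN (p + q) x + ∑ i : Fin (p + q) with i.val < p, x i

/-! The normal forms are polynomials in variables `x 1, x 2, x 3, …`; the one of signature `(p, q)`
involves only `x 1, …, x (p + q)`. We write them as functions of a sequence `x : ℕ → ZMod 2`. -/

def tilde03 (x₁ x₂ x₃ : ZMod 2) : ZMod 2 :=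
  x₁ * x₂ * x₃ + x₁ * x₂ + x₁ * x₃ + x₂ * x₃ + x₁ + x₂ + x₃

def tilde04 (x₁ _x₂ x₃ x₄ : ZMod 2) : ZMod 2 :=
  x₁ * x₃ * x₄ + x₁ * x₃ + x₁ * x₄ + x₃ * x₄ + x₁ + x₃ + x₄

def tilde05 (x₁ x₂ x₃ x₄ x₅ : ZMod 2) : ZMod 2 :=
  x₁ * x₂ * x₃ + x₁ * x₄ * x₅ + x₂ * x₃ + x₁ * x₄ + x₁ * x₅ + x₄ * x₅ + x₁ + x₄ + x₅

def tilde06 (x₁ x₂ x₃ x₄ x₅ x₆ : ZMod 2) : ZMod 2 :=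
  x₁ * x₃ * x₄ + x₁ * x₅ * x₆ + x₁ * x₂ + x₃ * x₄ + x₁ * x₅ + x₁ * x₆ + x₅ * x₆ +
    x₁ + x₂ + x₅ + x₆

/-- `α̃_{0,n}`, for `n ≥ 3` (the values for `n < 3` are irrelevant). -/
def tildeZero (n : ℕ) (x : ℕ → ZMod 2) : ZMod 2 :=
  if n % 4 = 3 then
    tilde03 (x 1) (x 2) (x 3) + ∑ i ∈ Finset.Icc 1 (n / 4),
      (x 1 + tilde05 (x 1) (x (4 * i)) (x (4 * i + 1)) (x (4 * i + 2)) (x (4 * i + 3)))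
  else if n % 4 = 0 then
    tilde04 (x 1) (x 2) (x 3) (x 4) + ∑ i ∈ Finset.Icc 1 (n / 4 - 1),
      (x 1 + tilde05 (x 1) (x (4 * i + 1)) (x (4 * i + 2)) (x (4 * i + 3)) (x (4 * i + 4)))
  else if n % 4 = 1 then
    tilde05 (x 1) (x 2) (x 3) (x 4) (x 5) + ∑ i ∈ Finset.Icc 1 (n / 4 - 1),
      (x 1 + tilde05 (x 1) (x (4 * i + 2)) (x (4 * i + 3)) (x (4 * i + 4)) (x (4 * i + 5)))
  else
    tilde06 (x 1) (x 2) (x 3) (x 4) (x 5) (x 6) + ∑ i ∈ Finset.Icc 1 (n / 4 - 1),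
      (x 1 + tilde05 (x 1) (x (4 * i + 3)) (x (4 * i + 4)) (x (4 * i + 5)) (x (4 * i + 6)))

def tilde12 (x₁ x₂ x₃ : ZMod 2) : ZMod 2 :=
  x₁ * x₂ * x₃ + x₁ * x₂ + x₁ * x₃ + x₂ * x₃ + x₁

def tilde22 (x₁ _x₂ x₃ x₄ : ZMod 2) : ZMod 2 :=
  x₁ * x₃ * x₄ + x₁ * x₃ + x₁ * x₄ + x₃ * x₄ + x₁

def tilde13 (x₁ x₂ x₃ x₄ : ZMod 2) : ZMod 2 :=
  x₁ * x₃ * x₄ + x₁ * x₃ + x₁ * x₄ + x₃ * x₄ + x₁ + x₂ + x₄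

def tilde23 (x₁ x₂ x₃ x₄ x₅ : ZMod 2) : ZMod 2 :=
  x₁ * x₂ * x₃ + x₁ * x₄ * x₅ + x₂ * x₃ + x₁ * x₄ + x₁ * x₅ + x₄ * x₅ + x₁

def tilde14 (x₁ x₂ x₃ x₄ x₅ : ZMod 2) : ZMod 2 :=
  x₁ * x₂ * x₃ + x₁ * x₄ * x₅ + x₂ * x₃ + x₁ * x₄ + x₁ * x₅ + x₄ * x₅ + x₁ + x₂ + x₃

def tilde33 (x₁ x₂ x₃ x₄ x₅ x₆ : ZMod 2) : ZMod 2 :=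
  x₁ * x₃ * x₄ + x₁ * x₅ * x₆ + x₁ * x₂ + x₃ * x₄ + x₁ * x₅ + x₁ * x₆ + x₅ * x₆ + x₁

def tilde24 (x₁ x₂ x₃ x₄ x₅ x₆ : ZMod 2) : ZMod 2 :=
  x₁ * x₃ * x₄ + x₁ * x₅ * x₆ + x₁ * x₂ + x₃ * x₄ + x₁ * x₅ + x₁ * x₆ + x₅ * x₆ +
    x₁ + x₂ + x₃ + x₄

def tilde15 (x₁ x₂ x₃ x₄ x₅ x₆ : ZMod 2) : ZMod 2 :=
  x₁ * x₃ * x₄ + x₁ * x₅ * x₆ + x₁ * x₂ + x₃ * x₄ + x₁ * x₅ + x₁ * x₆ + x₅ * x₆ +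
    x₁ + x₅ + x₆

def tilde25 (x₁ x₂ x₃ x₄ x₅ x₆ x₇ : ZMod 2) : ZMod 2 :=
  x₁ * x₂ * x₃ + x₁ * x₄ * x₅ + x₁ * x₆ * x₇ +
    x₁ * x₂ + x₁ * x₃ + x₂ * x₃ + x₄ * x₅ + x₁ * x₆ + x₁ * x₇ + x₆ * x₇ +
    x₁ + x₆ + x₇

def tilde26 (x₁ _x₂ x₃ x₄ x₅ x₆ x₇ x₈ : ZMod 2) : ZMod 2 :=
  x₁ * x₃ * x₄ + x₁ * x₅ * x₆ + x₁ * x₇ * x₈ +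
    x₁ * x₃ + x₁ * x₄ + x₃ * x₄ + x₅ * x₆ + x₁ * x₇ + x₁ * x₈ + x₇ * x₈ +
    x₁ + x₇ + x₈

def tilde36 (x₁ x₂ x₃ x₄ x₅ x₆ x₇ x₈ x₉ : ZMod 2) : ZMod 2 :=
  x₁ * x₂ * x₃ + x₁ * x₄ * x₅ + x₁ * x₆ * x₇ + x₁ * x₈ * x₉ +
    x₂ * x₃ + x₄ * x₅ + x₁ * x₆ + x₁ * x₇ + x₆ * x₇ + x₁ * x₈ + x₁ * x₉ + x₈ * x₉ +
    x₁ + x₈ + x₉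

/-- The eleven initial normal forms with `p, q > 0`. -/
def tildeBase (p q : ℕ) (x : ℕ → ZMod 2) : Option (ZMod 2) :=
  match p, q with
  | 1, 2 => some (tilde12 (x 1) (x 2) (x 3))
  | 2, 2 => some (tilde22 (x 1) (x 2) (x 3) (x 4))
  | 1, 3 => some (tilde13 (x 1) (x 2) (x 3) (x 4))
  | 2, 3 => some (tilde23 (x 1) (x 2) (x 3) (x 4) (x 5))
  | 1, 4 => some (tilde14 (x 1) (x 2) (x 3) (x 4) (x 5))
  | 3, 3 => some (tilde33 (x 1) (x 2) (x 3) (x 4) (x 5) (x 6))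
  | 2, 4 => some (tilde24 (x 1) (x 2) (x 3) (x 4) (x 5) (x 6))
  | 1, 5 => some (tilde15 (x 1) (x 2) (x 3) (x 4) (x 5) (x 6))
  | 2, 5 => some (tilde25 (x 1) (x 2) (x 3) (x 4) (x 5) (x 6) (x 7))
  | 2, 6 => some (tilde26 (x 1) (x 2) (x 3) (x 4) (x 5) (x 6) (x 7) (x 8))
  | 3, 6 => some (tilde36 (x 1) (x 2) (x 3) (x 4) (x 5) (x 6) (x 7) (x 8) (x 9))
  | _, _ => none

/-- `α̃_{p,q}` for `p, q > 0` and `p + q ≥ 3`: an initial form, or else reduced to initial forms by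
the rules `α̃_{p,q} = α̃_{q,p}`, `α̃_{p,q} = α̃_{p-2,q-2} + α̃_{2,3}(x_1, last four) + x_1` and
`α̃_{p,q} = α̃_{p+4,q-4}`. That all instances of these rules hold is shown in `tildeMixed_symm`,
`tildeMixed_glue` and `tildeMixed_shift`. The last branch is reached only if `p = 0`, `q = 0` or
`p + q < 3`, where the value is irrelevant. -/
def tildeMixed (p q : ℕ) (x : ℕ → ZMod 2) : ZMod 2 :=
  match tildeBase p q x with
  | some a => a
  | none =>
    if q < p then tildeMixed q p x
    else if 3 ≤ p then
      tildeMixed (p - 2) (q - 2) x +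
        tilde23 (x 1) (x (p + q - 3)) (x (p + q - 2)) (x (p + q - 1)) (x (p + q)) + x 1
    else if p + 4 < q then tildeMixed (p + 4) (q - 4) x
    else 0
termination_by (p + q, max p q, p)
decreasing_by
  · have h1 : q + p = p + q := by omega
    have h2 : max q p = max p q := by omega
    rw [h1, h2]
    exact Prod.Lex.right _ (Prod.Lex.right _ (by assumption))
  · exact Prod.Lex.left _ _ (by omega)
  · have h1 : p + 4 + (q - 4) = p + q := by omega
    rw [h1]
    exact Prod.Lex.right _ (Prod.Lex.left _ _ (by omega))

theorem tildeBase_of_lt {p q : ℕ} (h : q < p) (x : ℕ → ZMod 2) : tildeBase p q x = none := by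
  unfold tildeBase
  split <;> first | omega | rfl

theorem tildeMixed_symm (p q : ℕ) (x : ℕ → ZMod 2) : tildeMixed q p x = tildeMixed p q x := by
  rcases lt_trichotomy p q with h | h | h
  · rw [tildeMixed, tildeBase_of_lt h]
    simp [h]
  · rw [h]
  · conv_rhs => rw [tildeMixed, tildeBase_of_lt h]
    simp [h]

theorem tildeMixed_glue (p q : ℕ) (hp : 0 < p) (hq : 0 < q) (hn : 3 ≤ p + q)
    (h1 : ¬(p = 1 ∧ q = 4)) (h2 : ¬(p = 4 ∧ q = 1)) (x : ℕ → ZMod 2) :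
    tildeMixed (p + 2) (q + 2) x =
      tildeMixed p q x +
        tilde23 (x 1) (x (p + q + 1)) (x (p + q + 2)) (x (p + q + 3)) (x (p + q + 4)) + x 1 := by
  wlog hpq : p ≤ q generalizing p q
  · have := this q p hq hp (by omega) (by omega) (by omega) (by omega)
    rw [tildeMixed_symm, this, tildeMixed_symm q p, Nat.add_comm q p]
  have hb : tildeBase (p + 2) (q + 2) x = none := by
    unfold tildeBase
    split <;> first | omega | rfl
  rw [tildeMixed, hb]
  have e1 : ¬ (q + 2 < p + 2) := by omega
  have e2 : 3 ≤ p + 2 := by omega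
  have i1 : p + 2 + (q + 2) - 3 = p + q + 1 := by omega
  have i2 : p + 2 + (q + 2) - 2 = p + q + 2 := by omega
  have i3 : p + 2 + (q + 2) - 1 = p + q + 3 := by omega
  have i4 : p + 2 + (q + 2) = p + q + 4 := by omega
  simp only [if_neg e1, if_pos e2, Nat.add_sub_cancel]
  rw [i1, i2, i3, i4]

theorem tildeMixed_shift (p q : ℕ) (hp : 0 < p) (hq : 0 < q) (x : ℕ → ZMod 2) :
    tildeMixed p (q + 4) x = tildeMixed (p + 4) q x := by
  induction hs : p + q using Nat.strong_induction_on generalizing p q with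
  | _ s ih =>
  wlog hpq : p ≤ q generalizing p q
  · have := this q p hq hp (by omega) (by omega)
    rw [tildeMixed_symm (q + 4) p, tildeMixed_symm q (p + 4), this]
  rcases Nat.lt_or_ge p 3 with h3 | h3
  · by_cases h11 : p = 1 ∧ q = 1
    · rw [h11.1, h11.2]
      exact tildeMixed_symm _ _ _
    by_cases h22 : p = 2 ∧ q = 2
    · rw [h22.1, h22.2]
      exact tildeMixed_symm _ _ _
    have hb : tildeBase p (q + 4) x = none := by
      unfold tildeBase
      split <;> first | omega | rfl
    rw [tildeMixed, hb]
    have e1 : ¬ (q + 4 < p) := by omega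
    have e2 : ¬ (3 ≤ p) := by omega
    have e3 : p + 4 < q + 4 := by omega
    simp only [if_neg e1, if_neg e2, if_pos e3, Nat.add_sub_cancel]
  · obtain ⟨a, rfl⟩ : ∃ a, p = a + 2 := ⟨p - 2, by omega⟩
    obtain ⟨b, rfl⟩ : ∃ b, q = b + 2 := ⟨q - 2, by omega⟩
    have k1 := tildeMixed_glue a (b + 4) (by omega) (by omega) (by omega) (by omega) (by omega) x
    have k2 := tildeMixed_glue (a + 4) b (by omega) (by omega) (by omega) (by omega) (by omega) x
    have k3 := ih (a + b) (by omega) a b (by omega) (by omega) rfl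
    have i : a + 4 + b = a + (b + 4) := by omega
    rw [i] at k2
    rw [show b + 2 + 4 = b + 4 + 2 by omega, show a + 2 + 4 = a + 4 + 2 by omega, k1, k2, k3]

/-- The normal form of signature `(p, q)` (with `p + q ≥ 3`), as a polynomial in
`x 1, …, x (p + q)`. -/
def tildePoly (p q : ℕ) (x : ℕ → ZMod 2) : ZMod 2 :=
  if p = 0 then tildeZero q x
  else if q = 0 then tildeZero p x + x 1
  else tildeMixed p q x

/-- The coordinates `x_1, …, x_n` of a vector, numbered from `1` and followed by zeros. -/
def coord {n : ℕ} (x : Fin n → ZMod 2) (i : ℕ) : ZMod 2 :=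
  if h : 1 ≤ i ∧ i ≤ n then x ⟨i - 1, by omega⟩ else 0

/-- The normal form `α̃_{p,q}` on `(ZMod 2)^(p+q)`. -/
def alphaTilde (p q : ℕ) : Form (p + q) := fun x => tildePoly p q (coord x)

end HigherOctonion

open HigherOctonion

namespace HigherOctonion

/-! ### The generating function -/

/-! The generating-function identities hold monomial by monomial, so each reduces to a finite check
over `ZMod 2`.

For the normal forms, let s be the sum of all variables and e₂ the second elementary symmetric
function. Modulo 2 the third one is s·e₂, so α equals (s + 1)·e₂ + s + ∑ cᵢxᵢ, where c marks the
first p indices (`alpha_eq_core`). This form is symmetric up to c, and its quadratic part matters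
only where s = 0. All changes of variables used keep s, which becomes the variable x₁ of the normal
form; this is what lets separate blocks share x₁.

The main step (`core_eq_splitFour`) splits off four variables: α becomes the same form in the
remaining ones plus a function of s and the new four. A fixed 4 × 4 matrix brings that function to
α̃₀,₅ + x₁ (four indices with c = 0) or α̃₂,₃ + x₁ (two with c = 1 and two with c = 0). Comparing
different splittings, and a linear involution adding multiples of s, give the symmetries (p, q) ~
(q, p) and (p + 4, q) ~ (p, q + 4). Small signatures are settled by explicit matrices, the rest by
induction on p + q. The periodicity identities come from the recursive definition of the forms. -/

theorem sum_Ici_eq_add_sum_Ioi {n : ℕ} (i : Fin n) (f : Fin n → ZMod 2) :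
    ∑ j ∈ Finset.Ici i, f j = f i + ∑ j ∈ Finset.Ioi i, f j := by
  rw [← Finset.Ioi_insert, Finset.sum_insert (by simp)]

theorem isGeneratingFunction_alpha (p q : ℕ) :
    IsGeneratingFunction (twist p q) (alpha p q) where
  diag x := by
    have sq : ∀ a : ZMod 2, a * a = a := by decide
    have cube : ∀ a b c : ZMod 2, a * b * c + a * b * c + a * b * c = a * b * c := by decide
    simp only [twist, twistN, alpha, alphaN, sum_Ici_eq_add_sum_Ioi, sq, cube,
      Finset.sum_add_distrib]
    ring
  comm x y := by
    have cubic : ∀ a b c a' b' c' : ZMod 2, a * b * c' + a * b' * c + a' * b * c +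
        (a' * b' * c + a' * b * c' + a * b' * c') =
        (a + a') * (b + b') * (c + c') + a * b * c + a' * b' * c' := by decide
    have quad : ∀ a b a' b' : ZMod 2, a * b' + a' * b =
        (a + a') * (b + b') + a * b + a' * b' := by decide
    have lin : ∀ a b : ZMod 2, a * b + b * a = (a + b) + a + b := by decide
    have h3 := Finset.sum_congr (rfl : (Finset.univ : Finset (Fin (p + q))) = _) fun i _ =>
      Finset.sum_congr (rfl : Finset.Ioi i = _) fun j _ =>
      Finset.sum_congr (rfl : Finset.Ioi j = _) fun k _ =>
        cubic (x i) (x j) (x k) (y i) (y j) (y k)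
    have h2 := Finset.sum_congr (rfl : (Finset.univ : Finset (Fin (p + q))) = _) fun i _ =>
      Finset.sum_congr (rfl : Finset.Ioi i = _) fun j _ => quad (x i) (x j) (y i) (y j)
    have h1 := Finset.sum_congr (rfl : (Finset.univ : Finset (Fin (p + q))) = _) fun i _ =>
      lin (x i) (y i)
    have h0 := Finset.sum_congr
      (rfl : (Finset.univ.filter fun i : Fin (p + q) => i.val < p) = _) fun i _ =>
      lin (x i) (y i)
    simp only [twist, twistN, alpha, alphaN, sum_Ici_eq_add_sum_Ioi, Pi.add_apply]
    simp only [Finset.sum_add_distrib] at h3 h2 h1 h0 ⊢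
    linear_combination h3 + h2 + h1 + h0
  assoc x y z := by
    have cubic : ∀ a b c a' b' c' a'' b'' c'' : ZMod 2,
        (a * b * c' + a * b' * c + a' * b * c) +
        (a * b * (c' + c'') + a * (b' + b'') * c + (a' + a'') * b * c) +
        ((a + a') * (b + b') * c'' + (a + a') * b'' * (c + c') + a'' * (b + b') * (c + c')) +
        (a' * b' * c'' + a' * b'' * c' + a'' * b' * c') =
        (a + a' + a'') * (b + b' + b'') * (c + c' + c'') + (a + a') * (b + b') * (c + c') +
        (a + a'') * (b + b'') * (c + c'') + (a' + a'') * (b' + b'') * (c' + c'') +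
        a * b * c + a' * b' * c' + a'' * b'' * c'' := by decide +kernel
    -- Bilinear terms of the twist are 2-cocycles and drop out; on the other side, polynomials of
    -- degree at most 2 have zero third polarization. Only the cubic terms survive.
    have bil : ∀ a b' b'' a' : ZMod 2, a * b' + a * (b' + b'') + (a + a') * b'' + a' * b'' = 0 := by
      decide
    have quad : ∀ a b a' b' a'' b'' : ZMod 2,
        (a + a' + a'') * (b + b' + b'') + (a + a') * (b + b') +
        (a + a'') * (b + b'') + (a' + a'') * (b' + b'') + a * b + a' * b' + a'' * b'' = 0 := by
      decide
    have lin : ∀ a a' a'' : ZMod 2,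
        (a + a' + a'') + (a + a') + (a + a'') + (a' + a'') + a + a' + a'' = 0 := by decide
    have h3 := Finset.sum_congr (rfl : (Finset.univ : Finset (Fin (p + q))) = _) fun i _ =>
      Finset.sum_congr (rfl : Finset.Ioi i = _) fun j _ =>
      Finset.sum_congr (rfl : Finset.Ioi j = _) fun k _ =>
        cubic (x i) (x j) (x k) (y i) (y j) (y k) (z i) (z j) (z k)
    have h2 := Finset.sum_congr (rfl : (Finset.univ : Finset (Fin (p + q))) = _) fun i _ =>
      Finset.sum_congr (rfl : Finset.Ioi i = _) fun j _ =>
        quad (x i) (x j) (y i) (y j) (z i) (z j)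
    have h2' := Finset.sum_congr (rfl : (Finset.univ : Finset (Fin (p + q))) = _) fun i _ =>
      Finset.sum_congr (rfl : Finset.Ici i = _) fun j _ => bil (x i) (y j) (z j) (y i)
    have h1 := Finset.sum_congr (rfl : (Finset.univ : Finset (Fin (p + q))) = _) fun i _ =>
      lin (x i) (y i) (z i)
    have h0 := Finset.sum_congr
      (rfl : (Finset.univ.filter fun i : Fin (p + q) => i.val < p) = _) fun i _ =>
      lin (x i) (y i) (z i)
    have h0' := Finset.sum_congr
      (rfl : (Finset.univ.filter fun i : Fin (p + q) => i.val < p) = _) fun i _ =>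
      bil (x i) (y i) (z i) (y i)
    simp only [twist, twistN, alpha, alphaN, Pi.add_apply]
    simp only [Finset.sum_add_distrib, Finset.sum_const_zero] at h3 h2 h2' h1 h0 h0' ⊢
    linear_combination h3 + h2' + h0' - h2 - h1 - h0

/-! ### Elementary symmetric functions over `ZMod 2` -/

variable {ι κ : Type} [Fintype ι] [Fintype κ]

/-- The number of nonzero coordinates of a vector. -/
def wt (x : ι → ZMod 2) : ℕ := ∑ i, (x i).val

/-- The second elementary symmetric function. -/
def esymTwo (x : ι → ZMod 2) : ZMod 2 := ((wt x).choose 2 : ℕ)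

/-- The form `α` on an arbitrary finite index set, `c` being the indicator function of the set of
the indices `i ≤ p`. -/
def core (c x : ι → ZMod 2) : ZMod 2 :=
  (∑ i, x i + 1) * esymTwo x + ∑ i, x i + ∑ i, c i * x i

theorem cast_wt (x : ι → ZMod 2) : (wt x : ZMod 2) = ∑ i, x i := by
  simp [wt]

/-- Vandermonde's identity; it makes `esymTwo` a quadratic form with polarization the sum of
products of distinct coordinates. -/
theorem cast_choose_two_add (a b : ℕ) :
    (((a + b).choose 2 : ℕ) : ZMod 2) = (a.choose 2 : ℕ) + (b.choose 2 : ℕ) + a * b := by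
  induction b with
  | zero => simp
  | succ b ih =>
    rw [← add_assoc, Nat.choose_succ_succ' (a + b), Nat.choose_succ_succ' b]
    push_cast [ih, Nat.choose_one_right]
    ring

theorem cast_choose_two_val (a : ZMod 2) : ((a.val.choose 2 : ℕ) : ZMod 2) = 0 := by
  revert a
  decide

theorem esymTwo_sum (x : ι ⊕ κ → ZMod 2) :
    esymTwo x = esymTwo (fun i => x (Sum.inl i)) + esymTwo (fun i => x (Sum.inr i)) +
      (∑ i, x (Sum.inl i)) * ∑ i, x (Sum.inr i) := by
  have : wt x = wt (fun i => x (Sum.inl i)) + wt (fun i => x (Sum.inr i)) := by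
    simp [wt, Fintype.sum_sum_type]
  rw [esymTwo, this, cast_choose_two_add, cast_wt, cast_wt]
  rfl

theorem esymTwo_comp (σ : ι ≃ κ) (x : κ → ZMod 2) : esymTwo (x ∘ σ) = esymTwo x := by
  have : wt (x ∘ σ) = wt x := Equiv.sum_comp σ fun i => (x i).val
  rw [esymTwo, this, esymTwo]

theorem esymTwo_add_single [DecidableEq ι] (x : ι → ZMod 2) (k : ι) (s : ZMod 2) :
    esymTwo (x + Pi.single k s) = esymTwo x + s * (∑ i, x i + x k) := by
  have key (y : ι → ZMod 2) : esymTwo y = ((∑ i ∈ Finset.univ.erase k, (y i).val).choose 2 : ℕ) +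
      y k * ∑ i ∈ Finset.univ.erase k, y i := by
    have : wt y = (y k).val + ∑ i ∈ Finset.univ.erase k, (y i).val :=
      (Finset.add_sum_erase _ _ (Finset.mem_univ k)).symm
    rw [esymTwo, this, cast_choose_two_add, cast_choose_two_val]
    simp
  have h (i : ι) (hi : i ∈ Finset.univ.erase k) :
      (x + Pi.single k s : ι → ZMod 2) i = x i := by
    simp [Finset.ne_of_mem_erase hi]
  rw [key, key x, Finset.sum_congr rfl h, Finset.sum_congr rfl fun i hi => by rw [h i hi],
    ← Finset.add_sum_erase _ x (Finset.mem_univ k)]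
  generalize ∑ i ∈ Finset.univ.erase k, x i = e
  have : ∀ a s e : ZMod 2, (a + s) * e = a * e + s * (a + e + a) := by decide
  simp [this, add_assoc]

/-- With four variables each lies in three pairs and there are six pairs: 3 is odd, 6 is even. -/
theorem esymTwo_finFour_add_const (z : Fin 4 → ZMod 2) (c : ZMod 2) :
    esymTwo (fun i => z i + c) = esymTwo z + c * ∑ i, z i := by
  revert z c
  decide +kernel

theorem esymTwo_cons {n : ℕ} (a : ZMod 2) (x : Fin n → ZMod 2) :
    esymTwo (Fin.cons a x : Fin (n + 1) → ZMod 2) = esymTwo x + a * ∑ i, x i := by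
  have : wt (Fin.cons a x : Fin (n + 1) → ZMod 2) = a.val + wt x := by
    simp [wt, Fin.sum_univ_succ]
  rw [esymTwo, this, cast_choose_two_add, cast_choose_two_val, cast_wt]
  simp [esymTwo]

theorem sum_pairs_eq_esymTwo {n : ℕ} (x : Fin n → ZMod 2) :
    ∑ i : Fin n, ∑ j ∈ Finset.Ioi i, x i * x j = esymTwo x := by
  induction x using Fin.consInduction with
  | elim0 => rfl
  | cons a x ih =>
    rw [esymTwo_cons, ← ih, Fin.sum_univ_succ]
    simp [Fin.sum_Ioi_succ, Finset.mul_sum, add_comm]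

/-- For a vector of weight w this says C(w,3) ≡ w·C(w,2) mod 2. -/
theorem sum_triples_eq_mul_esymTwo {n : ℕ} (x : Fin n → ZMod 2) :
    ∑ i : Fin n, ∑ j ∈ Finset.Ioi i, ∑ k ∈ Finset.Ioi j, x i * x j * x k =
      (∑ i, x i) * esymTwo x := by
  induction x using Fin.consInduction with
  | elim0 => rfl
  | cons a x ih =>
    rw [esymTwo_cons, Fin.sum_univ_succ, Fin.sum_univ_succ (fun i => Fin.cons a x i)]
    simp only [Fin.sum_Ioi_zero, Fin.sum_Ioi_succ, Fin.cons_zero, Fin.cons_succ, ih]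
    rw [← sum_pairs_eq_esymTwo]
    simp only [mul_assoc, ← Finset.mul_sum]
    generalize ∑ i, x i * ∑ j ∈ Finset.Ioi i, x j = e
    generalize ∑ i, x i = s
    revert a e s
    decide

/-- The indicator function of the first `p` indices. -/
def firstIndicator (p n : ℕ) (i : Fin n) : ZMod 2 := if i.val < p then 1 else 0

theorem alpha_eq_core (p q : ℕ) (x : Fin (p + q) → ZMod 2) :
    alpha p q x = core (firstIndicator p (p + q)) x := by
  rw [alpha, alphaN, sum_pairs_eq_esymTwo, sum_triples_eq_mul_esymTwo, core, Finset.sum_filter]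
  simp only [firstIndicator, ite_mul, one_mul, zero_mul]
  ring

/-! ### Changes of variables -/

/-- The form `core c` is equivalent to the polynomial `F` in `x 1, …, x n`, by a change of
variables under which `x 1` becomes the sum of all the variables. -/
def Represents (c : ι → ZMod 2) (n : ℕ) (F : (ℕ → ZMod 2) → ZMod 2) : Prop :=
  ∃ g : (ι → ZMod 2) ≃ₗ[ZMod 2] (Fin n → ZMod 2), ∀ x y, (∀ i : Fin n, y (i + 1) = g x i) →
    y 1 = ∑ i, x i ∧ core c x = F y

theorem Represents.of_linearEquiv {c : ι → ZMod 2} {c' : κ → ZMod 2} {n : ℕ}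
    {F : (ℕ → ZMod 2) → ZMod 2} (h : Represents c n F)
    (T : (κ → ZMod 2) ≃ₗ[ZMod 2] (ι → ZMod 2)) (hs : ∀ x, ∑ i, T x i = ∑ i, x i)
    (hT : ∀ x, core c (T x) = core c' x) : Represents c' n F := by
  obtain ⟨g, hg⟩ := h
  exact ⟨T.trans g, fun x y hy => by rw [← hs, ← hT]; exact hg _ _ hy⟩

theorem exists_equiv_comp_eq [DecidableEq ι] [DecidableEq κ] (c : ι → ZMod 2) (c' : κ → ZMod 2)
    (hcard : ∀ a, Fintype.card {i // c i = a} = Fintype.card {i // c' i = a}) :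
    ∃ σ : ι ≃ κ, c' ∘ σ = c := by
  refine ⟨((Equiv.sigmaFiberEquiv c).symm.trans
    (Equiv.sigmaCongrRight fun a => Fintype.equivOfCardEq (hcard a))).trans
    (Equiv.sigmaFiberEquiv c'), ?_⟩
  funext i
  exact (Fintype.equivOfCardEq (hcard (c i)) ⟨i, rfl⟩).2

/-- Permuting indices fixes s and e₂, so only the numbers of ones and zeros of c matter; the index
set can be rearranged freely. -/
theorem Represents.of_card_eq [DecidableEq ι] [DecidableEq κ] {c : ι → ZMod 2} {c' : κ → ZMod 2}
    {n : ℕ} {F : (ℕ → ZMod 2) → ZMod 2} (h : Represents c n F)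
    (hcard : ∀ a, Fintype.card {i // c i = a} = Fintype.card {i // c' i = a}) :
    Represents c' n F := by
  obtain ⟨σ, rfl⟩ := exists_equiv_comp_eq c c' hcard
  have hs (f : κ → ZMod 2) : ∑ i, f (σ i) = ∑ i, f i := Equiv.sum_comp σ f
  refine h.of_linearEquiv (LinearEquiv.funCongrLeft (ZMod 2) (ZMod 2) σ) (fun x => hs x)
    fun x => ?_
  have : LinearEquiv.funCongrLeft (ZMod 2) (ZMod 2) σ x = x ∘ σ := rfl
  rw [this, core, core, esymTwo_comp]
  simp only [Function.comp_apply]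
  rw [hs, hs fun i => c' i * x i]

theorem Represents.congr {c : ι → ZMod 2} {n : ℕ} {F F' : (ℕ → ZMod 2) → ZMod 2}
    (h : Represents c n F) (hF : ∀ y, F y = F' y) : Represents c n F' := by
  rwa [← funext hF]

/-- Needed for signature (3, 6), whose normal form lists its variables in another order than the
construction yields. The variable x₁ must stay fixed. -/
theorem Represents.permute {c : ι → ZMod 2} {n : ℕ} {F F' : (ℕ → ZMod 2) → ZMod 2}
    (h : Represents c n F) (τ : Equiv.Perm (Fin n)) (u : ℕ → ℕ) (hu : u 1 = 1)
    (hτ : ∀ i : Fin n, u (i + 1) = (τ i : ℕ) + 1) (hF : ∀ y, F (y ∘ u) = F' y) : Represents c n F' := by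
  obtain ⟨g, hg⟩ := h
  refine ⟨g.trans (LinearEquiv.funCongrLeft (ZMod 2) (ZMod 2) τ.symm), fun x y hy => ?_⟩
  have := hg x (y ∘ u) fun i => by
    rw [Function.comp_apply, hτ, hy]
    simp [LinearEquiv.funCongrLeft_apply, LinearMap.funLeft_apply]
  rwa [hF, Function.comp_apply, hu] at this

/-- Splitting off four variables. -/
def splitFour [DecidableEq ι] (k : ι) :
    (ι ⊕ Fin 4 → ZMod 2) ≃ₗ[ZMod 2] (ι → ZMod 2) × (Fin 4 → ZMod 2) where
  toFun v :=
    (fun i => v (Sum.inl i) + (Pi.single k (∑ j, v (Sum.inr j)) : ι → ZMod 2) i,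
      fun j => v (Sum.inr j) + (v (Sum.inl k) + ∑ j, v (Sum.inr j)))
  invFun w := Sum.elim (fun i => w.1 i + (Pi.single k (∑ j, w.2 j) : ι → ZMod 2) i)
    fun j => w.2 j + w.1 k
  map_add' v w := by
    ext i
    · simp only [Pi.add_apply, Prod.mk_add_mk, Finset.sum_add_distrib, Pi.single_add]
      ring
    · simp only [Pi.add_apply, Prod.mk_add_mk, Finset.sum_add_distrib]
      ring
  map_smul' a v := by
    ext i
    · by_cases h : i = k
      · subst h
        simp [Finset.mul_sum, mul_add]
      · simp [h]
    · simp [Finset.mul_sum, mul_add]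
  left_inv v := by
    have h2 : ∀ a b : ZMod 2, a + b + b = a := by decide
    have h4 : ∀ a b c d e : ZMod 2, a + e + (b + e) + (c + e) + (d + e) = a + b + c + d := by
      decide
    ext (i | j)
    · by_cases h : i = k
      · subst h
        simp [Fin.sum_univ_four, h4, h2]
      · simp [h]
    · simp [h2]
  right_inv w := by
    have h2 : ∀ a b : ZMod 2, a + b + b = a := by decide
    have h3 : ∀ a b c : ZMod 2, a + b + (b + c + c) = a := by decide
    have h4 : ∀ a b c d e : ZMod 2, a + e + (b + e) + (c + e) + (d + e) = a + b + c + d := by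
      decide
    ext i
    · by_cases h : i = k
      · subst h
        simp [Fin.sum_univ_four, h4, h2]
      · simp [h]
    · simp [Fin.sum_univ_four, h4, h3]

theorem sum_splitFour [DecidableEq ι] (k : ι) (v : ι ⊕ Fin 4 → ZMod 2) :
    ∑ i, (splitFour k v).1 i = ∑ i, v i := by
  simp [splitFour, Fintype.sum_sum_type, Finset.sum_add_distrib]

/-- In the new coordinates (x, z) the old vector is x with ∑ z added at k, followed by the entries z
j + x k. The terms coupling x to z in e₂ then cancel, except through s = ∑ x, which is the old
total. Since d sums to 0, shifting all z j by x k leaves ∑ d j z j unchanged. -/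
theorem core_eq_splitFour [DecidableEq ι] (k : ι) (c : ι → ZMod 2) (d : Fin 4 → ZMod 2)
    (hd : ∑ j, d j = 0) (v : ι ⊕ Fin 4 → ZMod 2) :
    core (Sum.elim c d) v = core c (splitFour k v).1 +
      ((∑ i, (splitFour k v).1 i + 1) * (∑ j, (splitFour k v).2 j + esymTwo (splitFour k v).2) +
        (c k * ∑ j, (splitFour k v).2 j + ∑ j, d j * (splitFour k v).2 j)) := by
  obtain ⟨⟨x, z⟩, rfl⟩ := (splitFour k).symm.surjective v
  rw [LinearEquiv.apply_symm_apply]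
  have hv : (splitFour k).symm (x, z) = Sum.elim (x + Pi.single k (∑ j, z j)) fun j => z j + x k :=
    rfl
  have h4 (a : ZMod 2) : ∑ j, (z j + a) = ∑ j, z j := by
    have : (4 : ZMod 2) = 0 := by decide
    simp [Finset.sum_add_distrib, this]
  have hx : ∑ i, (x + Pi.single k (∑ j, z j) : ι → ZMod 2) i = ∑ i, x i + ∑ j, z j := by
    simp [Finset.sum_add_distrib]
  have hc : ∑ i, c i * (x + Pi.single k (∑ j, z j) : ι → ZMod 2) i =
      ∑ i, c i * x i + c k * ∑ j, z j := by
    simp [mul_add, Finset.sum_add_distrib, Pi.single_apply]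
  have hd' : ∑ j, d j * (z j + x k) = ∑ j, d j * z j := by
    simp [mul_add, Finset.sum_add_distrib, ← Finset.sum_mul, hd]
  rw [hv, core, esymTwo_sum]
  simp only [Fintype.sum_sum_type, Sum.elim_inl, Sum.elim_inr, hx, hc, hd', h4,
    esymTwo_add_single, esymTwo_finFour_add_const, core]
  generalize ∑ i, x i = e
  generalize ∑ i, c i * x i = l
  generalize ∑ j, z j = s
  generalize esymTwo z = r
  generalize ∑ j, d j * z j = m
  generalize esymTwo x = t
  -- Here a is the coordinate x k. The added terms s(e + a) + as + (e + s)s reduce to s² = s,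
  -- independent of a.
  have key : ∀ e s t r a : ZMod 2,
      (e + s + s + 1) * (t + s * (e + a) + (r + a * s) + (e + s) * s) + (e + s + s) =
        (e + 1) * t + e + (e + 1) * (s + r) := by decide
  linear_combination key e s t r (x k)

/-- Appending the coordinates of two vectors. -/
def appendEquiv (m n : ℕ) :
    ((Fin m → ZMod 2) × (Fin n → ZMod 2)) ≃ₗ[ZMod 2] (Fin (m + n) → ZMod 2) where
  toFun w := Fin.append w.1 w.2
  invFun v := (fun i => v (Fin.castAdd n i), fun j => v (Fin.natAdd m j))
  map_add' v w := by
    ext i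
    induction i using Fin.addCases <;> simp
  map_smul' a v := by
    ext i
    induction i using Fin.addCases <;> simp
  left_inv w := by simp
  right_inv v := by
    ext i
    induction i using Fin.addCases <;> simp

theorem Represents.append_four [DecidableEq ι] {c : ι → ZMod 2} {n : ℕ}
    {F : (ℕ → ZMod 2) → ZMod 2} (h : Represents c n F) (k : ι) {d : Fin 4 → ZMod 2}
    (hd : ∑ j, d j = 0) (R : ZMod 2 → (Fin 4 → ZMod 2) → ZMod 2)
    (e : (Fin 4 → ZMod 2) ≃ₗ[ZMod 2] (Fin 4 → ZMod 2))
    (hR : ∀ s z, (s + 1) * (∑ j, z j + esymTwo z) + (c k * ∑ j, z j + ∑ j, d j * z j) =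
      R s (e z)) :
    Represents (Sum.elim c d) (n + 4)
      fun y => F y + R (y 1) ![y (n + 1), y (n + 2), y (n + 3), y (n + 4)] := by
  obtain ⟨g, hg⟩ := h
  refine ⟨(splitFour k).trans ((g.prodCongr e).trans (appendEquiv n 4)), fun v y hy => ?_⟩
  -- The total is also the first variable of the old normal form, so the s in the splitting formula
  -- is `y 1`.
  have h1 := hg (splitFour k v).1 y fun i => by
    simpa [appendEquiv] using hy (Fin.castAdd 4 i)
  have h2 : ![y (n + 1), y (n + 2), y (n + 3), y (n + 4)] = e (splitFour k v).2 := by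
    have (j : Fin 4) : y (n + j + 1) = e (splitFour k v).2 j := by
      simpa [appendEquiv] using hy (Fin.natAdd n j)
    ext j
    rw [← this]
    fin_cases j <;> rfl
  refine ⟨h1.1.trans (sum_splitFour k v), ?_⟩
  simp only [core_eq_splitFour k c d hd, hR, h1.2, h2, ← h1.1]

/-- Adding s to the coordinates i and j preserves s and is an involution. It changes ∑ cₗxₗ by s
because c i + c j = 1. -/
theorem Represents.add_one [DecidableEq ι] {c : ι → ZMod 2} {n : ℕ} {F : (ℕ → ZMod 2) → ZMod 2}
    (h : Represents c n F) {i j : ι} (hi : c i = 1) (hj : c j = 0) :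
    Represents (fun l => c l + 1) n F := by
  have hij : j ≠ i := by
    rintro rfl
    rw [hi] at hj
    exact one_ne_zero hj
  have h2 (a : ZMod 2) : a + a = 0 := by
    revert a
    decide
  let f : (ι → ZMod 2) →ₗ[ZMod 2] (ι → ZMod 2) :=
    { toFun := fun x => x + Pi.single i (∑ l, x l) + Pi.single j (∑ l, x l)
      map_add' := fun x y => by
        simp only [Pi.add_apply, Finset.sum_add_distrib, Pi.single_add]
        abel
      map_smul' := fun a x => by
        simp only [Pi.smul_apply, ← Finset.smul_sum, Pi.single_smul, smul_add, RingHom.id_apply] }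
  have hs (x : ι → ZMod 2) : ∑ l, f x l = ∑ l, x l := by
    simp [f, Finset.sum_add_distrib, add_assoc, h2]
  have hf : Function.Involutive f := fun x => by
    have : f (f x) = f x + Pi.single i (∑ l, f x l) + Pi.single j (∑ l, f x l) := rfl
    rw [this, hs]
    funext l
    simp only [f, LinearMap.coe_mk, AddHom.coe_mk, Pi.add_apply]
    linear_combination h2 ((Pi.single i (∑ l, x l) : ι → ZMod 2) l) +
      h2 ((Pi.single j (∑ l, x l) : ι → ZMod 2) l)
  refine h.of_linearEquiv (LinearEquiv.ofInvolutive f hf) hs fun x => ?_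
  have hc : ∑ l, c l * f x l = ∑ l, c l * x l + ∑ l, x l := by
    simp [f, mul_add, Finset.sum_add_distrib, Pi.single_apply, hi, hj]
  have he : esymTwo (f x) = esymTwo x + (∑ l, x l) * (∑ l, x l + x i) +
      (∑ l, x l) * (∑ l, x l + ∑ l, x l + x j) := by
    have : f x = x + Pi.single i (∑ l, x l) + Pi.single j (∑ l, x l) := rfl
    rw [this, esymTwo_add_single, esymTwo_add_single]
    simp [Finset.sum_add_distrib, hij]
  -- The change of e₂ is a multiple of s, hence killed by the factor s + 1.
  have key : ∀ s t a b : ZMod 2, (s + 1) * (t + s * (s + a) + s * (s + s + b)) = (s + 1) * t := by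
    decide
  rw [LinearEquiv.coe_ofInvolutive, core, core, hs, hc, he, key]
  simp only [add_mul, one_mul, Finset.sum_add_distrib]

/-- Splitting four ones at i and four zeros at j leaves the same form: the linear terms in z are ∑ z
+ ∑ z = 0 and 0 respectively. -/
theorem Represents.elim_add_one [DecidableEq ι] {c : ι → ZMod 2} {n : ℕ}
    {F : (ℕ → ZMod 2) → ZMod 2} (h : Represents (Sum.elim c fun _ : Fin 4 => 1) n F) {i j : ι}
    (hi : c i = 1) (hj : c j = 0) : Represents (Sum.elim c fun _ : Fin 4 => 0) n F := by
  refine h.of_linearEquiv ((splitFour j).trans (splitFour i).symm) (fun x => ?_) fun x => ?_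
  · rw [← sum_splitFour i, ← sum_splitFour j]
    simp
  · rw [core_eq_splitFour i c _ (by decide), core_eq_splitFour j c _ (by decide)]
    simp only [LinearEquiv.trans_apply, LinearEquiv.apply_symm_apply, hi, hj, one_mul, zero_mul,
      CharTwo.add_self_eq_zero, Finset.sum_const_zero, add_zero]

/-! ### Signatures -/

/-- The form `α_{p,q}` is equivalent to the polynomial `F` in `x 1, …, x (p + q)`. -/
def Normal (p q : ℕ) (F : (ℕ → ZMod 2) → ZMod 2) : Prop :=
  Represents (Sum.elim (fun _ => 1) fun _ => 0 : Fin p ⊕ Fin q → ZMod 2) (p + q) F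

theorem card_elim [DecidableEq ι] [DecidableEq κ] (c : ι → ZMod 2) (d : κ → ZMod 2) (a : ZMod 2) :
    Fintype.card {i // Sum.elim c d i = a} =
      Fintype.card {i // c i = a} + Fintype.card {i // d i = a} := by
  rw [← Fintype.card_sum]
  exact Fintype.card_congr Equiv.subtypeSum

theorem card_const (n : ℕ) (a b : ZMod 2) :
    Fintype.card {_i : Fin n // b = a} = if b = a then n else 0 := by
  split_ifs with h <;> simp [h]

theorem card_firstIndicator (p q : ℕ) (a : ZMod 2) :
    Fintype.card {i // firstIndicator p (p + q) i = a} =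
      Fintype.card {i : Fin p ⊕ Fin q // Sum.elim (fun _ => (1 : ZMod 2)) (fun _ => 0) i = a} := by
  refine (Fintype.card_congr (finSumFinEquiv.subtypeEquiv fun i => ?_)).symm
  rcases i with i | i <;> simp [firstIndicator]

theorem Normal.swap {p q : ℕ} {F : (ℕ → ZMod 2) → ZMod 2} (h : Normal p q F) (hp : 0 < p)
    (hq : 0 < q) : Normal q p F := by
  have h1 := h.add_one (i := Sum.inl ⟨0, hp⟩) (j := Sum.inr ⟨0, hq⟩) rfl rfl
  have hc : (fun l => Sum.elim (fun _ => (1 : ZMod 2)) (fun _ => 0) l + 1) =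
      (Sum.elim (fun _ => 0) fun _ => 1 : Fin p ⊕ Fin q → ZMod 2) := by
    funext l
    rcases l with l | l
    · rfl
    · simp
  rw [hc] at h1
  rw [Normal, add_comm]
  refine h1.of_card_eq fun a => ?_
  simp only [card_elim, card_const]
  exact add_comm _ _

theorem Normal.shift {p q : ℕ} {F : (ℕ → ZMod 2) → ZMod 2} (h : Normal (p + 4) q F) (hp : 0 < p)
    (hq : 0 < q) : Normal p (q + 4) F := by
  have h1 : Represents (Sum.elim (Sum.elim (fun _ => 1) fun _ => 0 : Fin p ⊕ Fin q → ZMod 2)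
      fun _ : Fin 4 => 1) (p + 4 + q) F :=
    h.of_card_eq fun a => by
      simp only [card_elim, card_const]
      split_ifs <;> omega
  rw [show p + 4 + q = p + (q + 4) by omega] at h1
  refine (h1.elim_add_one (i := Sum.inl ⟨0, hp⟩) (j := Sum.inr ⟨0, hq⟩) rfl rfl).of_card_eq
    fun a => ?_
  simp only [card_elim, card_const]
  split_ifs <;> omega

/-- A change of variables bringing a quadratic form in four variables to its normal form. -/
def fourEquiv : (Fin 4 → ZMod 2) ≃ₗ[ZMod 2] (Fin 4 → ZMod 2) :=
  Matrix.toLin'OfInv (M' := !![0, 0, 1, 0; 0, 0, 0, 1; 1, 0, 1, 1; 0, 1, 1, 1])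
    (M := !![1, 1, 1, 0; 1, 1, 0, 1; 1, 0, 0, 0; 0, 1, 0, 0]) (by decide) (by decide)

/-- At s = 0 the two left sides are nondegenerate quadratic forms in z of Arf invariant 1 and 0,
like those on the right. One matrix serves both because it makes z 0 + z 1 the sum of the last two
new variables, which is the difference of `tilde05` and `tilde23`. -/
theorem fourEquiv_spec (s : ZMod 2) (z : Fin 4 → ZMod 2) :
    (s + 1) * (∑ j, z j + esymTwo z) =
      tilde05 s (fourEquiv z 0) (fourEquiv z 1) (fourEquiv z 2) (fourEquiv z 3) + s ∧
    (s + 1) * (∑ j, z j + esymTwo z) + (z 0 + z 1) =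
      tilde23 s (fourEquiv z 0) (fourEquiv z 1) (fourEquiv z 2) (fourEquiv z 3) + s := by
  have h : fourEquiv z = !![0, 0, 1, 0; 0, 0, 0, 1; 1, 0, 1, 1; 0, 1, 1, 1] *ᵥ z := rfl
  rw [h]
  clear h
  revert s z
  decide +kernel

theorem Normal.add_right {p q : ℕ} {F : (ℕ → ZMod 2) → ZMod 2} (h : Normal p q F) (hq : 0 < q) :
    Normal p (q + 4) fun y => F y + (tilde05 (y 1) (y (p + q + 1)) (y (p + q + 2)) (y (p + q + 3))
      (y (p + q + 4)) + y 1) := by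
  -- Splitting at an index with c = 0 leaves no linear term.
  refine (h.append_four (Sum.inr ⟨0, hq⟩) (d := fun _ => 0) (by simp)
    (fun s z => tilde05 s (z 0) (z 1) (z 2) (z 3) + s) fourEquiv fun s z => ?_).of_card_eq
    fun a => ?_
  · rw [← (fourEquiv_spec s z).1]
    simp
  · simp only [card_elim, card_const]
    split_ifs <;> omega

theorem Normal.glue {p q : ℕ} {F : (ℕ → ZMod 2) → ZMod 2} (h : Normal p q F) (hq : 0 < q) :
    Normal (p + 2) (q + 2) fun y => F y + (tilde23 (y 1) (y (p + q + 1)) (y (p + q + 2))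
      (y (p + q + 3)) (y (p + q + 4)) + y 1) := by
  have e : p + 2 + (q + 2) = p + q + 4 := by omega
  rw [Normal, e]
  refine (h.append_four (Sum.inr ⟨0, hq⟩) (d := ![1, 1, 0, 0]) (by decide)
    (fun s z => tilde23 s (z 0) (z 1) (z 2) (z 3) + s) fourEquiv fun s z => ?_).of_card_eq
    fun a => ?_
  · rw [← (fourEquiv_spec s z).2]
    simp [Fin.sum_univ_four]
  · have (b : ZMod 2) : Fintype.card {i // ![(1 : ZMod 2), 1, 0, 0] i = b} = 2 := by
      revert b
      decide
    simp only [card_elim, card_const, this]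
    revert a
    have (P : ZMod 2 → Prop) (h0 : P 0) (h1 : P 1) (a : ZMod 2) : P a := by
      fin_cases a <;> assumption
    apply this <;> simp

/-! ### The initial forms -/

/-- Reduces an initial form to a finite check over all vectors. The first row of `M` must be all
ones, to give s. -/
theorem normal_of_matrix {p q : ℕ} {F : (ℕ → ZMod 2) → ZMod 2} [NeZero (p + q)]
    (M M' : Matrix (Fin (p + q)) (Fin (p + q)) (ZMod 2)) (f : (Fin (p + q) → ZMod 2) → ZMod 2)
    (h : M * M' = 1) (h' : M' * M = 1)
    (hM : ∀ x, (M *ᵥ x) 0 = ∑ i, x i ∧ core (firstIndicator p (p + q)) x = f (M *ᵥ x))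
    (hF : ∀ y, f (fun i => y (i + 1)) = F y) : Normal p q F := by
  have : Represents (firstIndicator p (p + q)) (p + q) F := by
    refine ⟨Matrix.toLin'OfInv h' h, fun x y hy => ?_⟩
    have hy' : (fun i : Fin (p + q) => y (i + 1)) = M *ᵥ x := funext hy
    refine ⟨?_, by rw [(hM x).2, ← hy', hF]⟩
    rw [← (hM x).1, ← hy']
    simp
  exact this.of_card_eq fun a => card_firstIndicator p q a

theorem normal_zero_three :
    Normal 0 3 fun y => tilde03 (y 1) (y 2) (y 3) :=
  normal_of_matrix
    !![1, 1, 1; 0, 1, 0; 0, 0, 1]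
    !![1, 1, 1; 0, 1, 0; 0, 0, 1]
    (fun z => tilde03 (z 0) (z 1) (z 2))
    (by decide) (by decide) (by decide +kernel) fun _ => rfl

theorem normal_zero_four :
    Normal 0 4 fun y => tilde04 (y 1) (y 2) (y 3) (y 4) :=
  normal_of_matrix
    !![1, 1, 1, 1; 0, 0, 0, 1; 0, 1, 0, 1; 0, 0, 1, 1]
    !![1, 1, 1, 1; 0, 1, 1, 0; 0, 1, 0, 1; 0, 1, 0, 0]
    (fun z => tilde04 (z 0) (z 1) (z 2) (z 3))
    (by decide) (by decide) (by decide +kernel) fun _ => rfl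

theorem normal_zero_five :
    Normal 0 5 fun y => tilde05 (y 1) (y 2) (y 3) (y 4) (y 5) :=
  normal_of_matrix
    !![1, 1, 1, 1, 1; 0, 0, 0, 1, 0; 0, 0, 0, 0, 1; 0, 1, 0, 1, 1; 0, 0, 1, 1, 1]
    !![1, 1, 1, 1, 1; 0, 1, 1, 1, 0; 0, 1, 1, 0, 1; 0, 1, 0, 0, 0; 0, 0, 1, 0, 0]
    (fun z => tilde05 (z 0) (z 1) (z 2) (z 3) (z 4))
    (by decide) (by decide) (by decide +kernel) fun _ => rfl

theorem normal_zero_six :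
    Normal 0 6 fun y => tilde06 (y 1) (y 2) (y 3) (y 4) (y 5) (y 6) :=
  normal_of_matrix
    !![1, 1, 1, 1, 1, 1; 0, 0, 0, 0, 0, 1; 0, 0, 0, 1, 0, 1; 0, 0, 0, 0, 1, 1; 0, 1, 0, 1, 1, 1; 0, 0, 1, 1, 1, 1]
    !![1, 1, 1, 1, 1, 1; 0, 1, 1, 1, 1, 0; 0, 1, 1, 1, 0, 1; 0, 1, 1, 0, 0, 0; 0, 1, 0, 1, 0, 0; 0, 1, 0, 0, 0, 0]
    (fun z => tilde06 (z 0) (z 1) (z 2) (z 3) (z 4) (z 5))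
    (by decide) (by decide) (by decide +kernel) fun _ => rfl

theorem normal_one_two :
    Normal 1 2 fun y => tilde12 (y 1) (y 2) (y 3) :=
  normal_of_matrix
    !![1, 1, 1; 1, 0, 1; 0, 0, 1]
    !![0, 1, 1; 1, 1, 0; 0, 0, 1]
    (fun z => tilde12 (z 0) (z 1) (z 2))
    (by decide) (by decide) (by decide +kernel) fun _ => rfl

theorem normal_two_two :
    Normal 2 2 fun y => tilde22 (y 1) (y 2) (y 3) (y 4) :=
  normal_of_matrix
    !![1, 1, 1, 1; 0, 0, 0, 1; 1, 0, 0, 1; 0, 1, 0, 1]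
    !![0, 1, 1, 0; 0, 1, 0, 1; 1, 1, 1, 1; 0, 1, 0, 0]
    (fun z => tilde22 (z 0) (z 1) (z 2) (z 3))
    (by decide) (by decide) (by decide +kernel) fun _ => rfl

theorem normal_one_three :
    Normal 1 3 fun y => tilde13 (y 1) (y 2) (y 3) (y 4) :=
  normal_of_matrix
    !![1, 1, 1, 1; 0, 0, 0, 1; 1, 0, 0, 1; 0, 0, 1, 1]
    !![0, 1, 1, 0; 1, 1, 1, 1; 0, 1, 0, 1; 0, 1, 0, 0]
    (fun z => tilde13 (z 0) (z 1) (z 2) (z 3))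
    (by decide) (by decide) (by decide +kernel) fun _ => rfl

theorem normal_two_three :
    Normal 2 3 fun y => tilde23 (y 1) (y 2) (y 3) (y 4) (y 5) :=
  normal_of_matrix
    !![1, 1, 1, 1, 1; 0, 0, 0, 1, 0; 0, 0, 0, 0, 1; 1, 0, 0, 1, 1; 0, 1, 0, 1, 1]
    !![0, 1, 1, 1, 0; 0, 1, 1, 0, 1; 1, 1, 1, 1, 1; 0, 1, 0, 0, 0; 0, 0, 1, 0, 0]
    (fun z => tilde23 (z 0) (z 1) (z 2) (z 3) (z 4))
    (by decide) (by decide) (by decide +kernel) fun _ => rfl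

theorem normal_one_four :
    Normal 1 4 fun y => tilde14 (y 1) (y 2) (y 3) (y 4) (y 5) :=
  normal_of_matrix
    !![1, 1, 1, 1, 1; 0, 0, 0, 1, 0; 0, 0, 0, 0, 1; 1, 0, 1, 0, 0; 0, 0, 1, 1, 1]
    !![0, 1, 1, 1, 1; 1, 1, 1, 1, 0; 0, 1, 1, 0, 1; 0, 1, 0, 0, 0; 0, 0, 1, 0, 0]
    (fun z => tilde14 (z 0) (z 1) (z 2) (z 3) (z 4))
    (by decide) (by decide) (by decide +kernel) fun _ => rfl

theorem normal_three_three :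
    Normal 3 3 fun y => tilde33 (y 1) (y 2) (y 3) (y 4) (y 5) (y 6) :=
  normal_of_matrix
    !![1, 1, 1, 1, 1, 1; 0, 0, 0, 0, 0, 1; 0, 1, 0, 0, 0, 1; 0, 0, 1, 0, 0, 1; 1, 0, 0, 0, 1, 0; 0, 1, 1, 0, 1, 1]
    !![0, 1, 1, 1, 1, 1; 0, 1, 1, 0, 0, 0; 0, 1, 0, 1, 0, 0; 1, 1, 1, 1, 1, 0; 0, 1, 1, 1, 0, 1; 0, 1, 0, 0, 0, 0]
    (fun z => tilde33 (z 0) (z 1) (z 2) (z 3) (z 4) (z 5))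
    (by decide) (by decide) (by decide +kernel) fun _ => rfl

theorem normal_two_four :
    Normal 2 4 fun y => tilde24 (y 1) (y 2) (y 3) (y 4) (y 5) (y 6) :=
  normal_of_matrix
    !![1, 1, 1, 1, 1, 1; 0, 1, 0, 0, 0, 0; 0, 1, 0, 0, 1, 0; 0, 1, 0, 0, 0, 1; 1, 0, 0, 1, 0, 0; 0, 1, 0, 1, 1, 1]
    !![0, 1, 1, 1, 1, 1; 0, 1, 0, 0, 0, 0; 1, 1, 1, 1, 1, 0; 0, 1, 1, 1, 0, 1; 0, 1, 1, 0, 0, 0; 0, 1, 0, 1, 0, 0]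
    (fun z => tilde24 (z 0) (z 1) (z 2) (z 3) (z 4) (z 5))
    (by decide) (by decide) (by decide +kernel) fun _ => rfl

theorem normal_one_five :
    Normal 1 5 fun y => tilde15 (y 1) (y 2) (y 3) (y 4) (y 5) (y 6) :=
  normal_of_matrix
    !![1, 1, 1, 1, 1, 1; 1, 0, 0, 0, 0, 0; 1, 0, 0, 0, 1, 0; 1, 0, 0, 0, 0, 1; 1, 0, 1, 0, 1, 1; 1, 0, 0, 1, 1, 1]
    !![0, 1, 0, 0, 0, 0; 1, 1, 1, 1, 1, 1; 0, 1, 1, 1, 1, 0; 0, 1, 1, 1, 0, 1; 0, 1, 1, 0, 0, 0; 0, 1, 0, 1, 0, 0]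
    (fun z => tilde15 (z 0) (z 1) (z 2) (z 3) (z 4) (z 5))
    (by decide) (by decide) (by decide +kernel) fun _ => rfl

theorem Normal.congr {p q : ℕ} {F F' : (ℕ → ZMod 2) → ZMod 2} (h : Normal p q F)
    (hF : ∀ y, F y = F' y) : Normal p q F' :=
  Represents.congr h hF

theorem normal_two_five :
    Normal 2 5 fun y => tilde25 (y 1) (y 2) (y 3) (y 4) (y 5) (y 6) (y 7) := by
  refine ((normal_one_two.swap one_pos two_pos).add_right one_pos).congr fun y => ?_
  have : (2 : ZMod 2) = 0 := rfl
  simp only [tilde12, tilde05, tilde25]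
  linear_combination (y 1) * this

theorem normal_two_six :
    Normal 2 6 fun y => tilde26 (y 1) (y 2) (y 3) (y 4) (y 5) (y 6) (y 7) (y 8) := by
  refine (normal_two_two.add_right two_pos).congr fun y => ?_
  have : (2 : ZMod 2) = 0 := rfl
  simp only [tilde22, tilde05, tilde26]
  linear_combination (y 1) * this

theorem normal_three_six :
    Normal 3 6 fun y => tilde36 (y 1) (y 2) (y 3) (y 4) (y 5) (y 6) (y 7) (y 8) (y 9) := by
  have h := (normal_two_three.swap two_pos three_pos).add_right two_pos
  -- Exchanges x₄, x₅ with x₆, x₇ (indices here start at 0).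
  let τ : Equiv.Perm (Fin 9) :=
    ⟨![0, 1, 2, 5, 6, 3, 4, 7, 8], ![0, 1, 2, 5, 6, 3, 4, 7, 8], by decide, by decide⟩
  refine Represents.permute h τ (fun i => if h : i - 1 < 9 then τ ⟨i - 1, h⟩ + 1 else i) rfl
    (fun i => by simp) fun y => ?_
  have : (2 : ZMod 2) = 0 := rfl
  change tilde23 (y 1) (y 2) (y 3) (y 6) (y 7) + (tilde05 (y 1) (y 4) (y 5) (y 8) (y 9) + y 1) = _
  simp only [tilde23, tilde05, tilde36]
  linear_combination (y 1) * this

/-! ### All signatures -/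

theorem tildeZero_add_four (n : ℕ) (hn : 3 ≤ n) (x : ℕ → ZMod 2) :
    tildeZero (n + 4) x = tildeZero n x +
      (tilde05 (x 1) (x (n + 1)) (x (n + 2)) (x (n + 3)) (x (n + 4)) + x 1) := by
  have hd : (n + 4) / 4 = n / 4 + 1 := by omega
  have hm : (n + 4) % 4 = n % 4 := by omega
  unfold tildeZero
  rw [hd, hm]
  have hr : n % 4 < 4 := Nat.mod_lt _ (by norm_num)
  have hn4 := Nat.div_add_mod n 4
  generalize n / 4 = k at *
  generalize n % 4 = r at *
  subst hn4
  by_cases h3 : r = 3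
  · subst h3
    rw [if_pos rfl, if_pos rfl, Finset.sum_Icc_succ_top (by omega)]
    rw [show 4 * (k + 1) = 4 * k + 3 + 1 by ring]
    ring
  -- Outside residue 3 the sum stops at k - 1, and n ≥ 3 forces k ≥ 1, so the subtraction is not
  -- truncated. For residue 3 it stops at k, which may be 0.
  · obtain ⟨k, rfl⟩ : ∃ l, k = l + 1 := ⟨k - 1, by omega⟩
    simp only [Nat.add_sub_cancel]
    interval_cases r
    · simp only [show ¬(0 : ℕ) = 3 by decide, if_true, if_false]
      rw [Finset.sum_Icc_succ_top (by omega)]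
      ring_nf
    · simp only [show ¬(1 : ℕ) = 3 by decide, show ¬(1 : ℕ) = 0 by decide, if_true, if_false]
      rw [Finset.sum_Icc_succ_top (by omega)]
      ring_nf
    · simp only [show ¬(2 : ℕ) = 3 by decide, show ¬(2 : ℕ) = 0 by decide,
        show ¬(2 : ℕ) = 1 by decide, if_false]
      rw [Finset.sum_Icc_succ_top (by omega)]
      ring_nf
    · exact absurd rfl h3

theorem normal_zero (n : ℕ) (hn : 3 ≤ n) : Normal 0 n (tildeZero n) := by
  induction n using Nat.strong_induction_on with
  | _ n ih =>
    by_cases h : n < 7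
    · interval_cases n
      · exact normal_zero_three.congr fun y => by simp [tildeZero]
      · exact normal_zero_four.congr fun y => by simp [tildeZero]
      · exact normal_zero_five.congr fun y => by simp [tildeZero]
      · exact normal_zero_six.congr fun y => by simp [tildeZero]
    · obtain ⟨m, rfl⟩ : ∃ m, n = m + 4 := ⟨n - 4, by omega⟩
      refine ((ih m (by omega) (by omega)).add_right (by omega)).congr fun y => ?_
      rw [tildeZero_add_four m (by omega), zero_add]

/-- With c identically 1 the extra linear term is s, that is, `y 1`. -/
theorem Normal.zero_right {n : ℕ} {F : (ℕ → ZMod 2) → ZMod 2} (h : Normal 0 n F) :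
    Normal n 0 fun y => F y + y 1 := by
  obtain ⟨g, hg⟩ := h
  have h1 : Represents (fun _ : Fin 0 ⊕ Fin n => (1 : ZMod 2)) (n + 0) fun y => F y + y 1 := by
    rw [add_comm n]
    refine ⟨g, fun x y hy => ⟨(hg x y hy).1, ?_⟩⟩
    simp only [← (hg x y hy).2, (hg x y hy).1]
    simp [core]
  refine h1.of_card_eq fun a => ?_
  simp only [card_elim, card_const]
  split_ifs with h <;> simp [h]

/-- Induction on p + q with p ≤ q. Initial forms are known; otherwise p ≥ 3 is reached by gluing,
and p ≤ 2 with q > p + 4 by a shift from (p + 4, q - 4). -/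
theorem normal_mixed (p q : ℕ) (hp : 0 < p) (hq : 0 < q) (hn : 3 ≤ p + q) :
    Normal p q (tildeMixed p q) := by
  induction hs : p + q using Nat.strong_induction_on generalizing p q with
  | _ s ih =>
  wlog hpq : p ≤ q generalizing p q
  · exact ((this q p hq hp (by omega) (by omega) (by omega)).swap hq hp).congr
      (tildeMixed_symm p q)
  have glue (a b : ℕ) (ha : 0 < a) (hb : 0 < b) (hab : 3 ≤ a + b) (h1 : ¬(a = 1 ∧ b = 4))
      (h2 : ¬(a = 4 ∧ b = 1)) (hlt : a + b < s) :
      Normal (a + 2) (b + 2) (tildeMixed (a + 2) (b + 2)) :=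
    ((ih (a + b) hlt a b ha hb hab rfl).glue hb).congr fun y => by
      rw [tildeMixed_glue a b ha hb hab h1 h2, add_assoc (tildeMixed a b y)]
  have shift (r : ℕ) (hr : 0 < r) (h : Normal (p + 4) r (tildeMixed (p + 4) r)) :
      Normal p (r + 4) (tildeMixed p (r + 4)) :=
    (h.shift hp hr).congr fun y => (tildeMixed_shift p r hp hr y).symm
  have h25 : Normal 2 5 (tildeMixed 2 5) :=
    normal_two_five.congr fun y => by rw [tildeMixed]; rfl
  have h36 : Normal 3 6 (tildeMixed 3 6) :=
    normal_three_six.congr fun y => by rw [tildeMixed]; rfl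
  by_cases h3 : 3 ≤ p
  · obtain ⟨a, rfl⟩ : ∃ a, p = a + 2 := ⟨p - 2, by omega⟩
    obtain ⟨b, rfl⟩ : ∃ b, q = b + 2 := ⟨q - 2, by omega⟩
    -- Two initial forms have p ≥ 3: (3, 3), since (1, 1) is too small to glue to, and (3, 6), since
    -- rule (c) excludes (1, 4).
    by_cases h11 : a = 1 ∧ b = 1
    · obtain ⟨rfl, rfl⟩ := h11
      exact normal_three_three.congr fun y => by rw [tildeMixed]; rfl
    by_cases h14 : a = 1 ∧ b = 4
    · obtain ⟨rfl, rfl⟩ := h14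
      exact h36
    exact glue a b (by omega) (by omega) (by omega) h14 (by omega) (by omega)
  by_cases h6 : q ≤ p + 4
  · obtain rfl | rfl : p = 1 ∨ p = 2 := by omega
    · interval_cases q
      · omega
      · exact normal_one_two.congr fun y => by rw [tildeMixed]; rfl
      · exact normal_one_three.congr fun y => by rw [tildeMixed]; rfl
      · exact normal_one_four.congr fun y => by rw [tildeMixed]; rfl
      · exact normal_one_five.congr fun y => by rw [tildeMixed]; rfl
    · interval_cases q
      · exact normal_two_two.congr fun y => by rw [tildeMixed]; rfl
      · exact normal_two_three.congr fun y => by rw [tildeMixed]; rfl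
      · exact normal_two_four.congr fun y => by rw [tildeMixed]; rfl
      · exact h25
      · exact normal_two_six.congr fun y => by rw [tildeMixed]; rfl
  obtain ⟨r, rfl⟩ : ∃ r, q = r + 4 := ⟨q - 4, by omega⟩
  refine shift r (by omega) ?_
  -- The signature (p + 4, r) comes by gluing from (p + 2, r - 2), unless that is (3, 0) or the
  -- excluded (4, 1); then it is a swapped initial form.
  by_cases h12 : p = 1 ∧ r = 2
  · obtain ⟨rfl, rfl⟩ := h12
    exact (h25.swap (by omega) (by omega)).congr (tildeMixed_symm 5 2)
  by_cases h23 : p = 2 ∧ r = 3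
  · obtain ⟨rfl, rfl⟩ := h23
    exact (h36.swap (by omega) (by omega)).congr (tildeMixed_symm 6 3)
  obtain ⟨t, rfl⟩ : ∃ t, r = t + 2 := ⟨r - 2, by omega⟩
  exact glue (p + 2) t (by omega) (by omega) (by omega) (by omega) (by omega) (by omega)

theorem normal_tildePoly (p q : ℕ) (hn : 3 ≤ p + q) : Normal p q (tildePoly p q) := by
  by_cases hp : p = 0
  · subst hp
    exact (normal_zero q (by omega)).congr fun y => by simp [tildePoly]
  by_cases hq : q = 0
  · subst hq
    exact (normal_zero p (by omega)).zero_right.congr fun y => by simp [tildePoly, hp]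
  exact (normal_mixed p q (by omega) (by omega) hn).congr fun y => by simp [tildePoly, hp, hq]

theorem Normal.equivalent {p q : ℕ} (h : Normal p q (tildePoly p q)) :
    Equivalent (alpha p q) (alphaTilde p q) := by
  obtain ⟨g, hg⟩ := Represents.of_card_eq h fun a => (card_firstIndicator p q a).symm
  refine ⟨⟨LinearMap.toMatrix' g.toLinearMap, LinearMap.toMatrix' g.symm.toLinearMap, ?_, ?_⟩,
    fun x => ?_⟩
  · rw [← LinearMap.toMatrix'_comp]
    simp
  · rw [← LinearMap.toMatrix'_comp]
    simp
  · rw [alpha_eq_core, alphaTilde, LinearMap.toMatrix'_mulVec]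
    exact (hg x _ fun i => by simp [coord, Nat.succ_le_of_lt i.isLt]).2

end HigherOctonion

theorem mainTheorem1 :
    (∀ p q : ℕ, 3 ≤ p + q →
      IsGeneratingFunction (twist p q) (alpha p q) ∧
      Equivalent (alpha p q) (alphaTilde p q)) ∧
    (∀ (n : ℕ) (x : ℕ → ZMod 2), 3 ≤ n →
      tildePoly 0 (n + 4) x =
        tildePoly 0 n x + tilde05 (x 1) (x (n + 1)) (x (n + 2)) (x (n + 3)) (x (n + 4)) + x 1 ∧
      tildePoly (n + 4) 0 x =
        tildePoly n 0 x +
          (tilde05 (x 1) (x (n + 1)) (x (n + 2)) (x (n + 3)) (x (n + 4)) + x 1)) ∧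
    (∀ (p q : ℕ) (x : ℕ → ZMod 2), 0 < p → 0 < q → 3 ≤ p + q →
      (p, q) ≠ (1, 4) → (p, q) ≠ (4, 1) →
      tildePoly (p + 2) (q + 2) x =
        tildePoly p q x +
          tilde23 (x 1) (x (p + q + 1)) (x (p + q + 2)) (x (p + q + 3)) (x (p + q + 4)) + x 1) ∧
    (∀ (p q : ℕ) (x : ℕ → ZMod 2), 0 < p → 0 < q →
      tildePoly q p x = tildePoly p q x ∧
      tildePoly p (q + 4) x = tildePoly (p + 4) q x) := by
  have mixed (p q : ℕ) (x : ℕ → ZMod 2) (hp : 0 < p) (hq : 0 < q) :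
      tildePoly p q x = tildeMixed p q x := by
    simp [tildePoly, hp.ne', hq.ne']
  refine ⟨fun p q hn => ⟨isGeneratingFunction_alpha p q, (normal_tildePoly p q hn).equivalent⟩,
    fun n x hn => ?_, fun p q x hp hq hn h1 h2 => ?_, fun p q x hp hq => ?_⟩
  · have h0 : n ≠ 0 := by omega
    simp only [tildePoly, h0, tildeZero_add_four n hn, if_true, if_false, Nat.add_eq_zero_iff,
      false_and]
    constructor <;> ring
  · rw [mixed _ _ _ (by omega) (by omega), mixed _ _ _ hp hq]
    exact tildeMixed_glue p q hp hq hn (by simpa using h1) (by simpa using h2) x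
  · rw [mixed _ _ _ hq hp, mixed _ _ _ hp hq, mixed _ _ _ hp (by omega),
      mixed _ _ _ (by omega) hq]
    exact ⟨tildeMixed_symm p q x, tildeMixed_shift p q hp hq x⟩
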